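/- Graphs are undirected, without multiple edges, and may have loops. For graphs \(G,H\), let \(\mathrm{Hom}(G,H)\) be the poset of multi-homomorphisms from \(G\) to \(H\), i.e. of maps \(\eta : V(G)\to 2^{V(H)}\setminus\{\emptyset\}\) such that \((v,w)\in E(G)\) implies \(\eta(v)\times\eta(w)\subset E(H)\), ordered by \(\eta\le\eta'\) if and only if \(\eta(v)\subset\eta'(v)\) for all \(v\in V(G)\). An order-preserving map \(P\to Q\) of posets is called a homotopy equivalence if the induced map \(|P|\to|Q|\) between the geometric realizations of the order complexes is a homotopy equivalence. The girth of a graph is the minimal length of a cycle embedded in it, where a loop counts as a cycle of length \(1\) and all other cycles have length at least \(3\); it is \(\infty\) if there is no cycle. Lemma 4.4. Let \(T\) be a finite connected bipartite graph of diameter \(\Delta>0\), and let \(X\) be a finite graph whose girth is greater than \(2\Delta+4\). Then for every graph homomorphism \(u : K_2\to T\), the map \[u^* : \mathrm{Hom}(T,X)\to\mathrm{Hom}(K_2,X),\qquad \eta\mapsto\eta\circ u,\] is a homotopy equivalence. -/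

import Mathlib

noncomputable section

universe u v w

/-! ### Graphs with loops allowed -/

/-- A graph on the vertex set `V`: a symmetric relation. Loops are allowed, multiple edges are
not. -/
@[ext]
structure LoopGraph (V : Type u) where
  /-- adjacency, `v ∼ w` -/
  Adj : V → V → Prop
  symm : ∀ {a b : V}, Adj a b → Adj b a

namespace LoopGraph

/-- Graph homomorphisms: maps of vertices that preserve adjacency. -/
abbrev Hom {V : Type u} {W : Type v} (G : LoopGraph V) (H : LoopGraph W) : Type (max u v) :=
  G.Adj →r H.Adj

/-- The complete graph `K_n`: it has `n` vertices, and distinct vertices are adjacent. -/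
def K (n : ℕ) : LoopGraph (Fin n) where
  Adj a b := a ≠ b
  symm h := h.symm

/-- The simple graph obtained by deleting all loops. -/
def toSimpleGraph {V : Type u} (G : LoopGraph V) : SimpleGraph V where
  Adj a b := a ≠ b ∧ G.Adj a b
  symm := ⟨fun _ _ h => ⟨h.1.symm, G.symm h.2⟩⟩
  loopless := ⟨fun _ h => h.1 rfl⟩

/-- A graph is connected if it has a vertex and any two vertices are joined by a walk
(loops play no role). -/
def Connected {V : Type u} (G : LoopGraph V) : Prop := G.toSimpleGraph.Connected

/-- The diameter: the largest distance between two vertices (loops play no role for distances). -/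
def diam {V : Type u} (G : LoopGraph V) : ℕ := G.toSimpleGraph.diam

/-- A graph is bipartite if it is `2`-colourable, that is, if it maps to `K_2`. -/
def IsBipartite {V : Type u} (G : LoopGraph V) : Prop := Nonempty (Hom G (K 2))

open Classical in
/-- The girth: the minimal length of a cycle embedded in `G`, and `⊤` if there is none.
A loop is a cycle of length `1`; all other cycles have length at least `3`. -/
def egirth {V : Type u} (G : LoopGraph V) : ℕ∞ :=
  if ∃ v, G.Adj v v then 1 else G.toSimpleGraph.egirth

end LoopGraph

/-! ### The Hom complex -/

/-- A multi-homomorphism from `G` to `H`: each vertex of `G` is sent to a nonempty set of vertices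
of `H`, such that `(v, w) ∈ E(G)` implies `η(v) × η(w) ⊆ E(H)`. -/
@[ext]
structure MultiHom {V : Type u} {W : Type v} (G : LoopGraph V) (H : LoopGraph W) where
  /-- the underlying set-valued map -/
  toFun : V → Set W
  nonempty : ∀ a, (toFun a).Nonempty
  adj : ∀ {a b : V}, G.Adj a b → ∀ x ∈ toFun a, ∀ y ∈ toFun b, H.Adj x y

namespace MultiHom

variable {V : Type u} {W : Type v} {G : LoopGraph V} {H : LoopGraph W}

/-- The Hom complex `Hom(G, H)`: the poset of multi-homomorphisms, ordered by pointwise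
inclusion. -/
instance : PartialOrder (MultiHom G H) :=
  PartialOrder.lift MultiHom.toFun (fun _ _ h => MultiHom.ext h)

/-- The order-preserving map `f^* : Hom(G, H) → Hom(G', H)`, `η ↦ η ∘ f`, induced by a graph
homomorphism `f : G' → G`. -/
def pullback {V' : Type w} {G' : LoopGraph V'} (f : LoopGraph.Hom G' G) (H : LoopGraph W) :
    MultiHom G H →o MultiHom G' H where
  toFun η :=
    { toFun := fun a => η.toFun (f a)
      nonempty := fun a => η.nonempty (f a)
      adj := fun h => η.adj (f.map_rel h) }
  monotone' _ _ h a := h (f a)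

end MultiHom

/-! ### Geometric realization of abstract simplicial complexes -/

/-- A point of the geometric realization of an abstract simplicial complex `K`: barycentric
coordinates that are non-negative, sum to `1`, and whose support is a simplex of `K`. -/
@[ext]
structure Realization {ι : Type u} (K : AbstractSimplicialComplex ι) where
  /-- the barycentric coordinates -/
  weight : ι →₀ ℝ
  nonneg : ∀ i, 0 ≤ weight i
  sum_eq_one : (weight.sum fun _ r => r) = 1
  support_mem : weight.support ∈ K.faces

namespace Realization

variable {ι : Type u} {κ : Type v} {K : AbstractSimplicialComplex ι}
  {L : AbstractSimplicialComplex κ}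

open Classical in
/-- The inclusion of the closed geometric simplex spanned by a face `s`. -/
def ofFace (s : Finset ι) (hs : s ∈ K.faces) (t : stdSimplex ℝ s) : Realization K :=
  have hsum : ((Finsupp.onFinset s (fun i => if h : i ∈ s then t.1 ⟨i, h⟩ else 0)
      (fun i hi => by by_contra h; simp [h] at hi)).sum fun _ r => r) = 1 := by
    rw [Finsupp.onFinset_sum _ (fun _ => rfl), ← Finset.sum_attach, ← t.2.2]
    exact Finset.sum_congr rfl fun i _ => by simp
  { weight := Finsupp.onFinset s (fun i => if h : i ∈ s then t.1 ⟨i, h⟩ else 0)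
      (fun i hi => by by_contra h; simp [h] at hi)
    nonneg := fun i => by
      rw [Finsupp.onFinset_apply]
      split_ifs with h
      · exact t.2.1 _
      · exact le_rfl
    sum_eq_one := hsum
    support_mem := (K.isRelLowerSet_faces hs).2 Finsupp.support_onFinset_subset (by
      rw [Finset.nonempty_iff_ne_empty]
      intro h
      rw [Finsupp.sum, h] at hsum
      simp at hsum) }

/-- The weak topology: a set is open if and only if its preimage in each closed simplex is open. -/
instance : TopologicalSpace (Realization K) :=
  ⨆ s : K.faces, TopologicalSpace.coinduced (ofFace s.1 s.2) inferInstance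

/-- Maps out of the realization are continuous if they are continuous on each closed simplex. -/
theorem continuous_iff {Z : Type*} [TopologicalSpace Z] {g : Realization K → Z} :
    Continuous g ↔ ∀ (s : Finset ι) (hs : s ∈ K.faces), Continuous (g ∘ ofFace s hs) := by
  rw [continuous_iSup_dom]
  simp only [continuous_coinduced_dom, Subtype.forall]

theorem continuous_ofFace (s : Finset ι) (hs : s ∈ K.faces) :
    Continuous (ofFace (K := K) s hs) :=
  continuous_iff.1 continuous_id s hs

open Classical in
/-- The map of realizations induced by a map of vertices that sends simplices to simplices: it is
affine on each simplex. -/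
def mapFun (f : ι → κ) (hf : ∀ s ∈ K.faces, s.image f ∈ L.faces) (x : Realization K) :
    Realization L :=
  have hsum : ((x.weight.mapDomain f).sum fun _ r => r) = 1 := by
    rw [Finsupp.sum_mapDomain_index (fun _ => rfl) (fun _ _ _ => rfl)]
    exact x.sum_eq_one
  { weight := x.weight.mapDomain f
    nonneg := fun j => by
      rw [Finsupp.mapDomain, Finsupp.sum_apply]
      refine Finset.sum_nonneg fun i _ => ?_
      change 0 ≤ Finsupp.single (f i) (x.weight i) j
      rw [Finsupp.single_apply]
      split_ifs
      · exact x.nonneg i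
      · exact le_rfl
    sum_eq_one := hsum
    support_mem := (L.isRelLowerSet_faces (hf _ x.support_mem)).2 Finsupp.mapDomain_support (by
      rw [Finset.nonempty_iff_ne_empty]
      intro h
      rw [Finsupp.sum, h] at hsum
      simp at hsum) }

open Classical in
theorem continuous_mapFun (f : ι → κ) (hf : ∀ s ∈ K.faces, s.image f ∈ L.faces) :
    Continuous (mapFun (K := K) (L := L) f hf) := by
  rw [continuous_iff]
  intro s hs
  let q : s → (s.image f : Finset κ) := fun i => ⟨f i, Finset.mem_image_of_mem f i.2⟩
  have : mapFun (L := L) f hf ∘ ofFace s hs =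
      ofFace (s.image f) (hf s hs) ∘ stdSimplex.map q := by
    funext t
    ext j
    simp only [Function.comp_apply, mapFun, ofFace, Finsupp.onFinset_apply]
    rw [Finsupp.mapDomain, Finsupp.onFinset_sum _ (fun _ => by simp), Finsupp.finsetSum_apply,
      ← Finset.sum_attach]
    split_ifs with hj
    · change _ = (stdSimplex.map q t) ⟨j, hj⟩
      rw [stdSimplex.map_coe, FunOnFinite.linearMap_apply_apply, Finset.sum_filter]
      refine Finset.sum_congr rfl fun i _ => ?_
      rw [Finsupp.single_apply]
      simp only [q, Subtype.ext_iff, Subtype.coe_eta, Finset.coe_mem, dite_true]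
      rfl
    · refine Finset.sum_eq_zero fun i _ => ?_
      rw [Finsupp.single_apply, if_neg]
      rintro rfl
      exact hj (Finset.mem_image_of_mem f i.2)
  rw [this]
  exact (continuous_ofFace _ _).comp (stdSimplex.continuous_map q)

end Realization

/-! ### Classifying spaces of posets -/

/-- The order complex of a poset: its simplices are the nonempty finite chains. -/
def orderComplex (P : Type u) [PartialOrder P] : AbstractSimplicialComplex P where
  faces := {s | s.Nonempty ∧ IsChain (· ≤ ·) (s : Set P)}
  isRelLowerSet_faces := fun _ hs =>
    ⟨hs.1, fun _ hts ht => ⟨ht, hs.2.mono (Finset.coe_subset.2 hts)⟩⟩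
  singleton_mem a := by simp

/-- The classifying space `|P|` of a poset: the geometric realization of its order complex. -/
abbrev ClassifyingSpace (P : Type u) [PartialOrder P] : Type u := Realization (orderComplex P)

open Classical in
theorem image_mem_orderComplex {P : Type u} {Q : Type v} [PartialOrder P] [PartialOrder Q]
    (f : P →o Q) (s : Finset P) (hs : s ∈ (orderComplex P).faces) :
    s.image f ∈ (orderComplex Q).faces := by
  refine ⟨hs.1.image f, ?_⟩
  rw [Finset.coe_image]
  rintro _ ⟨a, ha, rfl⟩ _ ⟨b, hb, rfl⟩ _
  rcases hs.2.total ha hb with h | h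
  · exact Or.inl (f.monotone h)
  · exact Or.inr (f.monotone h)

/-- The continuous map `|f| : |P| → |Q|` induced by an order-preserving map `f : P → Q`. -/
def ClassifyingSpace.map {P : Type u} {Q : Type v} [PartialOrder P] [PartialOrder Q]
    (f : P →o Q) : C(ClassifyingSpace P, ClassifyingSpace Q) where
  toFun := Realization.mapFun f (image_mem_orderComplex f)
  continuous_toFun := Realization.continuous_mapFun f (image_mem_orderComplex f)

/-- A continuous map is a homotopy equivalence if it has a homotopy inverse. -/
def IsHomotopyEquiv {A : Type u} {B : Type v} [TopologicalSpace A] [TopologicalSpace B]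
    (f : C(A, B)) : Prop :=
  ∃ g : C(B, A), (g.comp f).Homotopic (ContinuousMap.id A) ∧
    (f.comp g).Homotopic (ContinuousMap.id B)

end

/-! Choose a colouring `c : T → K_2` with `c ∘ u = id`. Then `u^* ∘ c^*` is the identity, and the
task is to deform `c^* ∘ u^*` to the identity of `Hom(T, X)`. For each `η`, both `η` and its image
under `c^* ∘ u^*` lie in `colourHull c η`, which grows with `η`. By the carrier lemma
`map_homotopic_of_carrier` it suffices that each hull is contractible.

Fix a value `r` of `η` at an end of the edge `u`. In the graph spanned by the values of `η`, every
vertex has distance at most `Δ + 1` from `r`, so the girth bound makes this graph a tree rooted at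
`r`, with colours read off from the parity of the level. The hull therefore consists of the
multi-homomorphisms into this tree that respect parity. Moving vertices of top level to their
grandparents compares the identity with a map to a tree one level lower (`grow`, `fold`). At height
one the tree is a star, and the poset has a largest element. -/

noncomputable section

universe u v w

/-! ### Topology of realizations of finite complexes -/

namespace Realization

variable {ι : Type u} {K : AbstractSimplicialComplex ι}

open Classical in
theorem ofFace_weight_apply (s : Finset ι) (hs : s ∈ K.faces) (t : stdSimplex ℝ s) (i : ι) :
    (ofFace s hs t).weight i = if h : i ∈ s then t.1 ⟨i, h⟩ else 0 :=
  rfl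

theorem exists_ofFace_eq (x : Realization K) :
    ∃ t, ofFace x.weight.support x.support_mem t = x := by
  refine ⟨⟨fun i => x.weight i, fun i => x.nonneg i, ?_⟩, ?_⟩
  · exact (Finset.sum_coe_sort x.weight.support fun i => x.weight i).trans x.sum_eq_one
  · ext i
    rw [ofFace_weight_apply]
    split_ifs with h
    · rfl
    · exact (Finsupp.notMem_support_iff.1 h).symm

theorem continuous_weight_apply (i : ι) : Continuous fun x : Realization K => x.weight i := by
  classical
  rw [continuous_iff]
  intro s hs
  by_cases h : i ∈ s
  · have : ((fun x : Realization K => x.weight i) ∘ ofFace s hs) = fun t => t.1 ⟨i, h⟩ := by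
      funext t
      simp [ofFace_weight_apply, h]
    rw [this]
    exact (continuous_apply _).comp continuous_subtype_val
  · have : ((fun x : Realization K => x.weight i) ∘ ofFace s hs) = fun _ => 0 := by
      funext t
      simp [ofFace_weight_apply, h]
    rw [this]
    exact continuous_const

/-- Finitely many closed simplices cover the realization. Compactness turns the continuous injection
into coordinate space into an embedding, so that continuity of maps into the realization can be
tested on coordinates despite the weak topology. -/
instance [Finite ι] : CompactSpace (Realization K) := by
  classical
  have := Fintype.ofFinite ι
  refine ⟨?_⟩
  have : (Set.univ : Set (Realization K)) = ⋃ s : K.faces, Set.range (ofFace s.1 s.2) := by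
    refine (Set.eq_univ_of_forall fun x => ?_).symm
    exact Set.mem_iUnion.2 ⟨⟨_, x.support_mem⟩, x.exists_ofFace_eq⟩
  rw [this]
  exact isCompact_iUnion fun s => isCompact_range (continuous_ofFace s.1 s.2)

/-- The realization of a finite complex embeds into the space of barycentric coordinates. -/
theorem isEmbedding_weight [Finite ι] :
    Topology.IsEmbedding fun (x : Realization K) (i : ι) => x.weight i := by
  refine (Continuous.isClosedEmbedding (continuous_pi continuous_weight_apply) ?_).isEmbedding
  intro x y h
  ext i
  exact congrFun h i

instance [Finite ι] : T2Space (Realization K) := isEmbedding_weight.t2Space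

theorem continuousOn_of_weight [Finite ι] {Z : Type*} [TopologicalSpace Z] {f : Z → Realization K}
    {s : Set Z} (h : ∀ i, ContinuousOn (fun z => (f z).weight i) s) : ContinuousOn f s := by
  rw [isEmbedding_weight.continuousOn_iff]
  exact continuousOn_pi.2 h

theorem continuous_of_weight [Finite ι] {Z : Type*} [TopologicalSpace Z] {f : Z → Realization K}
    (h : ∀ i, Continuous fun z => (f z).weight i) : Continuous f := by
  rw [isEmbedding_weight.continuous_iff]
  exact continuous_pi h

theorem support_nonempty (x : Realization K) : x.weight.support.Nonempty :=
  (K.isRelLowerSet_faces x.support_mem).1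

open Classical in
/-- The point at time `t` of the segment from `x` to `y` inside a common simplex. -/
def segment (x y : Realization K)
    (h : x.weight.support ∪ y.weight.support ∈ K.faces) (t : unitInterval) : Realization K :=
  have hsum : (((1 - t : ℝ) • x.weight + (t : ℝ) • y.weight).sum fun _ r => r) = 1 := by
    rw [Finsupp.sum_add_index' (fun _ => rfl) (fun _ _ _ => rfl),
      Finsupp.sum_smul_index' (fun _ => rfl), Finsupp.sum_smul_index' (fun _ => rfl)]
    simp only [smul_eq_mul]
    rw [← Finsupp.mul_sum, ← Finsupp.mul_sum, x.sum_eq_one, y.sum_eq_one]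
    ring
  { weight := (1 - t : ℝ) • x.weight + (t : ℝ) • y.weight
    nonneg := fun i => by
      have h1 := mul_nonneg (sub_nonneg.2 t.2.2) (x.nonneg i)
      have h2 := mul_nonneg t.2.1 (y.nonneg i)
      simpa using add_nonneg h1 h2
    sum_eq_one := hsum
    support_mem := (K.isRelLowerSet_faces h).2
      (Finsupp.support_add.trans (Finset.union_subset_union Finsupp.support_smul
        Finsupp.support_smul)) (by
      rw [Finset.nonempty_iff_ne_empty]
      intro h
      rw [Finsupp.sum, h] at hsum
      simp at hsum) }

open Classical in
/-- Maps into a finite complex that are contiguous are homotopic. -/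
theorem homotopic_of_union_mem [Finite ι] {Z : Type*} [TopologicalSpace Z]
    (f g : C(Z, Realization K))
    (h : ∀ z, (f z).weight.support ∪ (g z).weight.support ∈ K.faces) : f.Homotopic g := by
  refine ⟨⟨⟨fun p => segment (f p.2) (g p.2) (h p.2) p.1, ?_⟩, fun z => ?_, fun z => ?_⟩⟩
  · refine continuous_of_weight fun i => ?_
    have hf := (continuous_weight_apply i).comp (f.continuous.comp
      (continuous_snd (X := unitInterval)))
    have hg := (continuous_weight_apply i).comp (g.continuous.comp
      (continuous_snd (X := unitInterval)))
    have ht : Continuous fun p : unitInterval × Z => (p.1 : ℝ) :=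
      continuous_subtype_val.comp continuous_fst
    exact ((continuous_const.sub ht).mul hf).add (ht.mul hg)
  · ext i
    simp [segment]
  · ext i
    simp [segment]

end Realization

/-! ### Homotopies between maps induced by comparable order-preserving maps -/

namespace ClassifyingSpace

variable {P : Type u} {Q : Type v} {R : Type w} [PartialOrder P] [PartialOrder Q] [PartialOrder R]

theorem map_weight (f : P →o Q) (x : ClassifyingSpace P) :
    (map f x).weight = x.weight.mapDomain f :=
  rfl

theorem map_id : map (OrderHom.id : P →o P) = ContinuousMap.id _ := by
  ext x : 1
  refine Realization.ext ?_
  exact Finsupp.mapDomain_id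

theorem map_comp (g : Q →o R) (f : P →o Q) : map (g.comp f) = (map g).comp (map f) := by
  ext x : 1
  refine Realization.ext ?_
  exact Finsupp.mapDomain_comp (v := x.weight) (f := f) (g := g)

theorem exists_of_mem_support_map {f : P →o Q} {x : ClassifyingSpace P} {q : Q}
    (hq : q ∈ (map f x).weight.support) : ∃ p ∈ x.weight.support, f p = q := by
  classical
  exact Finset.mem_image.1 (Finsupp.mapDomain_support hq)

theorem isChain_support (x : ClassifyingSpace P) :
    IsChain (· ≤ ·) (x.weight.support : Set P) :=
  x.support_mem.2

theorem le_total_of_mem_support {x : ClassifyingSpace P} {a b : P} (ha : a ∈ x.weight.support)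
    (hb : b ∈ x.weight.support) : a ≤ b ∨ b ≤ a :=
  x.isChain_support.total ha hb

/-- Order-preserving maps that agree outside of one point, where they are comparable, induce
homotopic maps. -/
theorem map_homotopic_of_eq_off [Finite Q] (f g : P →o Q) (p : P) (hp : f p ≤ g p)
    (h : ∀ a, a ≠ p → f a = g a) : (map f).Homotopic (map g) := by
  classical
  refine Realization.homotopic_of_union_mem _ _ fun x => ⟨?_, ?_⟩
  · exact (Realization.support_nonempty _).mono Finset.subset_union_left
  -- Unless `a = b = p`, one of the two points differs from `p`, so both values come from the same
  -- monotone map.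
  · have key : ∀ a ∈ x.weight.support, ∀ b ∈ x.weight.support, f a ≤ g b ∨ g b ≤ f a := by
      intro a ha b hb
      rcases eq_or_ne a p with rfl | hap
      · rcases eq_or_ne b a with rfl | hba
        · exact Or.inl hp
        · rw [← h b hba]
          exact (le_total_of_mem_support ha hb).imp (fun h => f.monotone h) (fun h => f.monotone h)
      · rw [h a hap]
        exact (le_total_of_mem_support ha hb).imp (fun h => g.monotone h) (fun h => g.monotone h)
    rw [Finset.coe_union]
    rintro y (hy | hy) z (hz | hz) -
    · exact le_total_of_mem_support hy hz
    · obtain ⟨a, ha, rfl⟩ := exists_of_mem_support_map hy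
      obtain ⟨b, hb, rfl⟩ := exists_of_mem_support_map hz
      exact key a ha b hb
    · obtain ⟨a, ha, rfl⟩ := exists_of_mem_support_map hy
      obtain ⟨b, hb, rfl⟩ := exists_of_mem_support_map hz
      exact (key b hb a ha).symm
    · exact le_total_of_mem_support hy hz

/-- Comparable order-preserving maps of finite posets induce homotopic maps. -/
theorem map_homotopic_of_le [Finite P] [Finite Q] {f g : P →o Q} (hfg : f ≤ g) :
    (map f).Homotopic (map g) := by
  classical
  induction hn : {a | f a ≠ g a}.ncard using Nat.strong_induction_on generalizing f with
  | _ n ih =>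
    rcases {a | f a ≠ g a}.eq_empty_or_nonempty with he | hne
    · have : f = g := by
        ext a
        by_contra h
        exact (Set.mem_empty_iff_false a).1 (he ▸ h)
      rw [this]
    · obtain ⟨p, hp⟩ := (Set.toFinite {a | f a ≠ g a}).exists_maximal hne
      have hup : ∀ q, p < q → f q = g q := fun q hq => by
        by_contra h
        exact hq.not_ge (hp.2 h hq.le)
      -- Raising `f` at one point stays monotone because `p` is maximal among the points of
      -- disagreement: above `p` the maps already agree.
      let f' : P →o Q :=
        { toFun := Function.update f p (g p)
          monotone' := by
            intro a b hab
            rcases eq_or_ne a p with ha | ha <;> rcases eq_or_ne b p with hb | hb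
            · rw [ha, hb]
            · rw [ha, Function.update_self, Function.update_of_ne hb,
                hup b (lt_of_le_of_ne (ha ▸ hab) (Ne.symm hb))]
              exact g.monotone (ha ▸ hab)
            · rw [hb, Function.update_self, Function.update_of_ne ha]
              exact (f.monotone (hb ▸ hab)).trans (hfg _)
            · rw [Function.update_of_ne ha, Function.update_of_ne hb]
              exact f.monotone hab }
      have hf'p : f' p = g p := Function.update_self p (g p) f
      have hf' : ∀ a, a ≠ p → f' a = f a := fun a ha => Function.update_of_ne ha (g p) f
      have h1 : (map f).Homotopic (map f') :=
        map_homotopic_of_eq_off f f' p (hf'p ▸ hfg p) fun a ha => (hf' a ha).symm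
      have hle : f' ≤ g := fun a => by
        rcases eq_or_ne a p with rfl | ha
        · exact hf'p.le
        · exact (hf' a ha).le.trans (hfg a)
      refine h1.trans (ih _ ?_ hle rfl)
      rw [← hn]
      refine Set.ncard_lt_ncard ⟨fun a ha => ?_, fun h => ?_⟩
      · have hap : a ≠ p := by
          rintro rfl
          exact ha hf'p
        exact fun h => ha ((hf' a hap).trans h)
      · exact h hp.1 hf'p

/-- The identity lies below the constant map at `p`, so the two are homotopic. -/
theorem contractibleSpace_of_isTop [Finite P] {p : P} (hp : IsTop p) :
    ContractibleSpace (ClassifyingSpace P) := by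
  classical
  rw [contractible_iff_id_nullhomotopic]
  refine ⟨⟨Finsupp.single p 1, fun i => ?_, by simp, ?_⟩, ?_⟩
  · rw [Finsupp.single_apply]
    split_ifs <;> norm_num
  · rw [Finsupp.support_single _ one_ne_zero]
    exact ⟨by simp, by simp⟩
  · rw [← map_id]
    have h := map_homotopic_of_le (f := OrderHom.id) (g := OrderHom.const P p) fun a => hp a
    convert h using 1
    ext x : 1
    refine Realization.ext ?_
    rw [map_weight]
    change Finsupp.single p 1 = Finsupp.mapDomain (fun _ => p) x.weight
    rw [Finsupp.mapDomain, ← Finsupp.single_sum, x.sum_eq_one]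

/-- A retract of posets that is homotopic to the identity transports contractibility. -/
theorem contractibleSpace_of_homotopic_id (i : Q →o P) (ρ : P →o Q)
    (h : (map (i.comp ρ)).Homotopic (ContinuousMap.id _))
    (hQ : ContractibleSpace (ClassifyingSpace Q)) :
    ContractibleSpace (ClassifyingSpace P) := by
  rw [contractible_iff_id_nullhomotopic]
  obtain ⟨y, hy⟩ := id_nullhomotopic (ClassifyingSpace Q)
  refine ⟨map i y, h.symm.trans ?_⟩
  rw [map_comp]
  have h2 := ((ContinuousMap.Homotopic.refl (map i)).comp (hy.comp (.refl (map ρ))))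
  exact h2

end ClassifyingSpace

/-! ### Extending carried maps one cone at a time -/

namespace Realization

variable {ι : Type u} {K : AbstractSimplicialComplex ι}

theorem isClosed_support_subset (S : Set ι) :
    IsClosed {x : Realization K | (x.weight.support : Set ι) ⊆ S} := by
  have : {x : Realization K | (x.weight.support : Set ι) ⊆ S} =
      ⋂ i ∈ Sᶜ, {x : Realization K | x.weight i = 0} := by
    ext x
    simp only [Set.mem_ofPred_eq, Set.mem_iInter, Set.mem_compl_iff]
    refine forall_congr' fun i => ?_
    rw [Finset.mem_coe, Finsupp.mem_support_iff]
    exact not_imp_comm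
  rw [this]
  exact isClosed_biInter fun i _ => isClosed_eq (continuous_weight_apply i) continuous_const

theorem sum_erase (x : Realization K) (q : ι) :
    ((x.weight.erase q).sum fun _ r => r) = 1 - x.weight q := by
  rw [eq_sub_iff_add_eq', ← x.sum_eq_one]
  exact Finsupp.add_sum_erase' x.weight q (fun _ r => r) (fun _ => rfl)

open Classical in
/-- The projection of a point from the vertex `q` to the opposite face. -/
def project (q : ι) (x : Realization K) : Realization K :=
  if h : x.weight q < 1 then
    have hsum : (((1 - x.weight q)⁻¹ • x.weight.erase q).sum fun _ r => r) = 1 := by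
      rw [Finsupp.sum_smul_index' (fun _ => rfl)]
      simp only [smul_eq_mul]
      rw [← Finsupp.mul_sum, sum_erase]
      exact inv_mul_cancel₀ (sub_pos.2 h).ne'
    { weight := (1 - x.weight q)⁻¹ • x.weight.erase q
      nonneg := fun i => by
        refine mul_nonneg (inv_nonneg.2 (sub_pos.2 h).le) ?_
        rw [Finsupp.erase_apply]
        split_ifs
        · exact le_rfl
        · exact x.nonneg i
      sum_eq_one := hsum
      support_mem := (K.isRelLowerSet_faces x.support_mem).2
        (Finsupp.support_smul.trans (by
          rw [Finsupp.support_erase]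
          exact Finset.erase_subset _ _)) (by
        rw [Finset.nonempty_iff_ne_empty]
        intro h
        rw [Finsupp.sum, h] at hsum
        simp at hsum) }
  else x

theorem project_weight {q : ι} {x : Realization K} (h : x.weight q < 1) :
    (project q x).weight = (1 - x.weight q)⁻¹ • x.weight.erase q := by
  rw [project, dif_pos h]

theorem project_of_weight_eq_zero {q : ι} {x : Realization K} (h : x.weight q = 0) :
    project q x = x := by
  refine Realization.ext ?_
  rw [project_weight (h ▸ zero_lt_one), h, sub_zero, inv_one, one_smul]
  exact Finsupp.erase_of_notMem_support (Finsupp.notMem_support_iff.2 h)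

theorem support_project_subset {q : ι} {x : Realization K} (h : x.weight q < 1) :
    ((project q x).weight.support : Set ι) ⊆ (x.weight.support : Set ι) \ {q} := by
  classical
  rw [project_weight h]
  refine (Finset.coe_subset.2 Finsupp.support_smul).trans ?_
  rw [Finsupp.support_erase, Finset.coe_erase]

theorem continuousOn_project [Finite ι] (q : ι) :
    ContinuousOn (project (K := K) q) {x | x.weight q < 1} := by
  refine continuousOn_of_weight fun i => ?_
  have h : ContinuousOn (fun x : Realization K => (1 - x.weight q)⁻¹ * x.weight.erase q i)
      {x | x.weight q < 1} := by
    refine ContinuousOn.mul ?_ ?_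
    · refine ContinuousOn.inv₀ ?_ fun x hx => (sub_pos.2 hx).ne'
      exact (continuous_const.sub (continuous_weight_apply q)).continuousOn
    · classical
      by_cases hi : i = q
      · subst hi
        simp only [Finsupp.erase_same]
        exact continuousOn_const
      · simp only [Finsupp.erase_ne hi]
        exact (continuous_weight_apply i).continuousOn
  refine h.congr fun x hx => ?_
  simp only [project_weight hx]
  rfl

end Realization

namespace ClassifyingSpace

open Realization

variable {R : Type u} [PartialOrder R]

/-- A map on the subcomplex `|L|` extends over the cone with apex `q` and base `|Iio q|`, if it
maps the base to a contractible set. -/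
theorem exists_extension_insert [Finite R] {Y : Type*} [TopologicalSpace Y] {L : Set R}
    (hL : IsLowerSet L) {q : R} (hq : q ∉ L) (F : ClassifyingSpace R → Y)
    (hF : ContinuousOn F {x | (x.weight.support : Set R) ⊆ L}) (hqL : Set.Iio q ⊆ L) {A : Set Y}
    [ContractibleSpace A]
    (hA : ∀ x : ClassifyingSpace R, (x.weight.support : Set R) ⊆ Set.Iio q → F x ∈ A) :
    ∃ G : ClassifyingSpace R → Y,
      ContinuousOn G {x | (x.weight.support : Set R) ⊆ insert q L} ∧
      (∀ x, (x.weight.support : Set R) ⊆ L → G x = F x) ∧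
      ∀ x : ClassifyingSpace R, q ∈ x.weight.support → G x ∈ A := by
  classical
  obtain ⟨y₀, ⟨H⟩⟩ := id_nullhomotopic A
  -- The half of the cone next to its base. The bound `1 / 2` keeps the projection from `q` defined;
  -- there the contraction of `A` runs at time `2 * x.weight q`, and the rest of the cone goes to
  -- `y₀`.
  let D : Set (ClassifyingSpace R) :=
    {x | (x.weight.support : Set R) ⊆ Set.Iic q ∧ x.weight q ≤ 1 / 2}
  have hDlt : ∀ x ∈ D, x.weight q < 1 := fun x hx => hx.2.trans_lt (by norm_num)
  have hDsupp : ∀ x ∈ D, ((project q x).weight.support : Set R) ⊆ Set.Iio q := fun x hx i hi => by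
    have := support_project_subset (hDlt x hx) hi
    exact lt_of_le_of_ne (hx.1 this.1) this.2
  have hD : ∀ x ∈ D, F (project q x) ∈ A := fun x hx => hA _ (hDsupp x hx)
  let time : ClassifyingSpace R → unitInterval := fun x =>
    Set.projIcc (0 : ℝ) 1 zero_le_one (2 * x.weight q)
  have htime : Continuous time :=
    continuous_projIcc.comp (continuous_const.mul (continuous_weight_apply q))
  -- The default `y₀` is the intended value near the apex. Outside the subcomplex all that matters
  -- is that it lies in `A`.
  let C : ClassifyingSpace R → A := fun x =>
    if h : x ∈ D then H (time x, ⟨F (project q x), hD x h⟩) else y₀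
  let G : ClassifyingSpace R → Y := fun x => if x.weight q = 0 then F x else C x
  have hsupp : ∀ x : ClassifyingSpace R, (x.weight.support : Set R) ⊆ L → x.weight q = 0 :=
    fun x hx => Finsupp.notMem_support_iff.1 fun h => hq (hx h)
  have hGL : ∀ x, (x.weight.support : Set R) ⊆ L → G x = F x := fun x hx => if_pos (hsupp x hx)
  have hGD : ∀ x ∈ D, G x = C x := by
    intro x hx
    by_cases h0 : x.weight q = 0
    · have ht : time x = 0 := Set.projIcc_of_le_left _ (by rw [h0, mul_zero])
      simp only [G, C, h0, dif_pos hx, if_true, ht, H.apply_zero]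
      change F x = F (project q x)
      rw [project_of_weight_eq_zero h0]
    · exact if_neg h0
  have hGt : ∀ x, 1 / 2 ≤ x.weight q → G x = y₀ := by
    intro x hx
    have h0 : x.weight q ≠ 0 := by linarith
    have ht : time x = 1 := Set.projIcc_of_right_le _ (by linarith)
    simp only [G, C, h0, if_false]
    split_ifs with h
    · rw [ht, H.apply_one]
      rfl
    · rfl
  refine ⟨G, ?_, hGL, fun x hx => ?_⟩
  · have hcov : {x : ClassifyingSpace R | (x.weight.support : Set R) ⊆ insert q L} ⊆
        ({x | (x.weight.support : Set R) ⊆ L} ∪ D) ∪ {x | 1 / 2 ≤ x.weight q} := by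
      intro x hx
      by_cases h0 : x.weight q = 0
      · refine Or.inl (Or.inl fun i hi => (hx hi).resolve_left ?_)
        rintro rfl
        exact Finsupp.mem_support_iff.1 hi h0
      · rcases le_total (x.weight q) (1 / 2) with h | h
        · refine Or.inl (Or.inr ⟨fun i hi => ?_, h⟩)
          have hqx : q ∈ x.weight.support := Finsupp.mem_support_iff.2 h0
          rcases hx hi with rfl | hiL
          · exact le_rfl
          -- A vertex of the lower set `L` comparable to `q` lies below `q`, since otherwise `q`
          -- would be in `L`.
          · exact (le_total_of_mem_support hi hqx).resolve_right fun h => hq (hL h hiL)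
        · exact Or.inr h
    have hDc : IsClosed D :=
      (isClosed_support_subset _).inter
        (isClosed_le (continuous_weight_apply q) continuous_const)
    have hLc := isClosed_support_subset (K := orderComplex R) L
    have hGDc : ContinuousOn G D := by
      have hproj : ContinuousOn (fun x => F (project q x)) D :=
        hF.comp ((continuousOn_project q).mono hDlt) fun x hx => (hDsupp x hx).trans hqL
      have : ContinuousOn (fun x => (C x : Y)) D := by
        rw [continuousOn_iff_continuous_domRestrict] at hproj ⊢
        have h2 : Continuous fun x : D => ((H (time x, ⟨F (project q x), hD x x.2⟩) : A) : Y) :=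
          continuous_subtype_val.comp (H.continuous.comp
            ((htime.comp continuous_subtype_val).prodMk (hproj.subtype_mk _)))
        refine h2.congr fun x => ?_
        simp [C, x.2]
      exact this.congr hGD
    refine ContinuousOn.mono ?_ hcov
    refine ContinuousOn.union_of_isClosed ?_ ?_ (hLc.union hDc)
      (isClosed_le continuous_const (continuous_weight_apply q))
    · exact (hF.congr hGL).union_of_isClosed hGDc hLc hDc
    · exact continuousOn_const.congr hGt
  · simp only [G, if_neg (Finsupp.mem_support_iff.1 hx)]
    exact (C x).2

theorem exists_max_support (x : ClassifyingSpace R) :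
    ∃ r ∈ x.weight.support, (x.weight.support : Set R) ⊆ Set.Iic r := by
  obtain ⟨r, hr⟩ := x.weight.support.exists_maximal x.support_nonempty
  refine ⟨r, hr.1, fun i hi => ?_⟩
  rcases le_total_of_mem_support hi hr.1 with h | h
  · exact h
  · exact hr.2 hi h

/-- A map on the subcomplex `|L|` that is carried by an increasing family of contractible sets
extends to the whole classifying space. -/
theorem exists_extension [Finite R] {Y : Type*} [TopologicalSpace Y] (Φ : R → Set Y)
    (hΦ : Monotone Φ) (hc : ∀ r, ContractibleSpace (Φ r)) {L : Set R} (hL : IsLowerSet L)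
    (F : ClassifyingSpace R → Y) (hF : ContinuousOn F {x | (x.weight.support : Set R) ⊆ L})
    (hcar : ∀ x : ClassifyingSpace R, (x.weight.support : Set R) ⊆ L →
      ∀ r ∈ x.weight.support, (x.weight.support : Set R) ⊆ Set.Iic r → F x ∈ Φ r) :
    ∃ G : C(ClassifyingSpace R, Y), ∀ x, (x.weight.support : Set R) ⊆ L → G x = F x := by
  induction hn : Lᶜ.ncard using Nat.strong_induction_on generalizing L F with
  | _ n ih =>
    rcases Lᶜ.eq_empty_or_nonempty with he | hne
    · rw [Set.compl_empty_iff] at he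
      subst he
      simp only [Set.subset_univ, Set.ofPred_true, continuousOn_univ] at hF
      exact ⟨⟨F, hF⟩, fun _ _ => rfl⟩
    -- By minimality everything below `q` is in `L`, so adjoining `q` attaches a cone over `|Iio
    -- q|`, and its base is carried into `Φ q`.
    · obtain ⟨q, hq⟩ := (Set.toFinite Lᶜ).exists_minimal hne
      have hqL : Set.Iio q ⊆ L := fun i hi => by
        by_contra h
        exact (Set.mem_Iio.1 hi).not_ge (hq.2 h (Set.mem_Iio.1 hi).le)
      have hcq := hc q
      obtain ⟨G, hGc, hGF, hGA⟩ := exists_extension_insert hL hq.1 F hF hqL (A := Φ q)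
        fun x hx => by
          obtain ⟨r, hr, hrx⟩ := x.exists_max_support
          exact hΦ (hx hr).le (hcar x (hx.trans hqL) r hr hrx)
      have hL' : IsLowerSet (insert q L) := by
        rintro a b hba (rfl | ha)
        · rcases hba.eq_or_lt with rfl | h
          · exact Set.mem_insert _ _
          · exact Set.mem_insert_of_mem _ (hqL h)
        · exact Set.mem_insert_of_mem _ (hL hba ha)
      obtain ⟨G', hG'⟩ := ih _ (by
          rw [← hn]
          refine Set.ncard_lt_ncard ⟨Set.compl_subset_compl.2 (Set.subset_insert _ _), fun h => ?_⟩
          exact h hq.1 (Set.mem_insert _ _)) hL' G hGc (fun x hx r hr hrx => by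
          by_cases hqx : q ∈ x.weight.support
          · exact hΦ (hrx hqx) (hGA x hqx)
          · have hxL : (x.weight.support : Set R) ⊆ L := fun i hi =>
              (hx hi).resolve_left fun h => hqx (h ▸ hi)
            rw [hGF x hxL]
            exact hcar x hxL r hr hrx) rfl
      exact ⟨G', fun x hx => (hG' x (hx.trans (Set.subset_insert _ _))).trans (hGF x hx)⟩

end ClassifyingSpace

/-! ### The carrier lemma for order-preserving maps -/

/-- The poset `left < top > right`. -/
inductive Cospan
  | left
  | right
  | top

namespace Cospan

instance : Finite Cospan := by
  refine Set.finite_univ_iff.1 ((Set.toFinite {left, right, top}).subset fun a _ => ?_)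
  cases a <;> simp

instance : PartialOrder Cospan where
  le a b := a = b ∨ b = top
  le_refl _ := Or.inl rfl
  le_trans a b c hab hbc := by
    rcases hab with rfl | rfl
    · exact hbc
    · rcases hbc with rfl | rfl <;> exact Or.inr rfl
  le_antisymm a b hab hba := by
    rcases hab with rfl | rfl
    · rfl
    · rcases hba with h | h
      · exact h.symm
      · exact h

theorem le_apex (a : Cospan) : a ≤ top := Or.inr rfl

theorem eq_of_le_of_ne_top {a b : Cospan} (h : a ≤ b) (hb : b ≠ top) : a = b := h.resolve_right hb

/-- The inclusion of a poset in its product with the cospan, at height `z`. -/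
def incl (P : Type u) [PartialOrder P] (z : Cospan) : P →o P × Cospan where
  toFun p := (p, z)
  monotone' _ _ h := ⟨h, le_rfl⟩

theorem incl_le_incl_top (P : Type u) [PartialOrder P] (z : Cospan) : incl P z ≤ incl P top :=
  fun _ => ⟨le_rfl, le_apex z⟩

end Cospan

namespace ClassifyingSpace

open Realization

variable {P : Type u} {Q : Type v} [PartialOrder P] [PartialOrder Q]

/-- The classifying space of a subset of a finite poset is a subcomplex of the classifying
space. -/
def homeomorphSupportSubset [Finite Q] (S : Set Q) :
    ClassifyingSpace S ≃ₜ {x : ClassifyingSpace Q | (x.weight.support : Set Q) ⊆ S} := by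
  classical
  let f : ClassifyingSpace S → {x : ClassifyingSpace Q | (x.weight.support : Set Q) ⊆ S} :=
    fun x => ⟨map (OrderHom.Subtype.val (· ∈ S)) x, fun q hq => by
      obtain ⟨p, -, rfl⟩ := exists_of_mem_support_map hq
      exact p.2⟩
  have hf : Continuous f := (map _).continuous.subtype_mk _
  have hinj : Function.Injective f := fun x y h => by
    refine Realization.ext ?_
    have h' := congrArg Realization.weight (congrArg Subtype.val h)
    exact Finsupp.mapDomain_injective Subtype.val_injective h'
  have hsurj : Function.Surjective f := fun ⟨x, hx⟩ => by
    have hw : (x.weight.subtypeDomain (· ∈ S)).mapDomain Subtype.val = x.weight := by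
      ext q
      by_cases hq : q ∈ S
      · exact Finsupp.mapDomain_apply Subtype.val_injective _ (⟨q, hq⟩ : S)
      · rw [Finsupp.mapDomain_of_notMem_range _ _ (by simpa using hq)]
        exact (Finsupp.notMem_support_iff.1 fun h => hq (hx h)).symm
    have hsum : ((x.weight.subtypeDomain (· ∈ S)).sum fun _ r => r) = 1 := by
      rw [← x.sum_eq_one, ← Finsupp.sum_mapDomain_index (f := Subtype.val) (h := fun _ r => r)
        (fun _ => rfl) (fun _ _ _ => rfl), hw]
    refine ⟨⟨x.weight.subtypeDomain (· ∈ S), fun i => x.nonneg i, hsum, ?_, ?_⟩, ?_⟩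
    · rw [Finset.nonempty_iff_ne_empty]
      intro h
      rw [Finsupp.sum, h] at hsum
      simp at hsum
    · intro a ha b hb _
      simp only [Finsupp.support_subtypeDomain, Finset.mem_coe, Finset.mem_subtype] at ha hb
      exact le_total_of_mem_support (x := x) ha hb
    · exact Subtype.ext (Realization.ext hw)
  exact (Continuous.homeoOfEquivCompactToT2 (f := Equiv.ofBijective f ⟨hinj, hsurj⟩) hf)

/-- Order-preserving maps of finite posets are homotopic if they have a common contractible
carrier. -/
theorem map_homotopic_of_carrier [Finite P] [Finite Q] (f g : P →o Q) (S : P → Set Q)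
    (hS : Monotone S) (hf : ∀ p, f p ∈ S p) (hg : ∀ p, g p ∈ S p)
    (hc : ∀ p, ContractibleSpace (ClassifyingSpace (S p))) : (map f).Homotopic (map g) := by
  classical
  -- Two disjoint copies of `P`: `f` is prescribed on the left, `g` on the right, and the map is
  -- extended over `P × Cospan`.
  let L : Set (P × Cospan) := {r | r.2 ≠ .top}
  have hL : IsLowerSet L := fun a b hba ha hb => ha (by
    have h : b.2 ≤ a.2 := hba.2
    rw [Cospan.eq_of_le_of_ne_top h ha] at hb
    exact hb)
  let Φ : P × Cospan → Set (ClassifyingSpace Q) := fun r =>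
    {x | (x.weight.support : Set Q) ⊆ S r.1}
  have hΦ : Monotone Φ := fun a b h x hx => hx.trans (hS h.1)
  have hΦc : ∀ r, ContractibleSpace (Φ r) := fun r =>
    have := hc r.1
    (homeomorphSupportSubset (S r.1)).symm.contractibleSpace
  let fst : P × Cospan →o P := OrderHom.fst
  let F : ClassifyingSpace (P × Cospan) → ClassifyingSpace Q := fun x =>
    if (x.weight.support : Set (P × Cospan)) ⊆ {r | r.2 = .left} then map (f.comp fst) x
    else map (g.comp fst) x
  have hcov : {x : ClassifyingSpace (P × Cospan) | (x.weight.support : Set _) ⊆ L} ⊆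
      {x | (x.weight.support : Set (P × Cospan)) ⊆ {r | r.2 = .left}} ∪
      {x | (x.weight.support : Set (P × Cospan)) ⊆ {r | r.2 = .right}} := by
    intro x hx
    obtain ⟨r, hr, hrx⟩ := x.exists_max_support
    have h : ∀ i ∈ x.weight.support, i.2 = r.2 := fun i hi =>
      Cospan.eq_of_le_of_ne_top (hrx hi).2 (hx hr)
    rcases hr2 : r.2 with _ | _ | _
    · exact Or.inl fun i hi => (h i hi).trans hr2
    · exact Or.inr fun i hi => (h i hi).trans hr2
    · exact (hx hr hr2).elim
  have hFl : ∀ x : ClassifyingSpace (P × Cospan),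
      (x.weight.support : Set (P × Cospan)) ⊆ {r | r.2 = .left} → F x = map (f.comp fst) x :=
    fun x hx => if_pos hx
  have hFr : ∀ x : ClassifyingSpace (P × Cospan),
      (x.weight.support : Set (P × Cospan)) ⊆ {r | r.2 = .right} → F x = map (g.comp fst) x :=
    fun x hx => if_neg fun h => by
      obtain ⟨r, hr⟩ := x.support_nonempty
      have h1 : r.2 = .left := h hr
      have h2 : r.2 = .right := hx hr
      rw [h1] at h2
      cases h2
  obtain ⟨G, hG⟩ := exists_extension Φ hΦ hΦc hL F
    (by
      refine ContinuousOn.mono ?_ hcov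
      exact ((map _).continuous.continuousOn.congr hFl).union_of_isClosed
        ((map _).continuous.continuousOn.congr hFr)
        (isClosed_support_subset _) (isClosed_support_subset _))
    (by
      intro x hx r hr hrx
      rcases hcov hx with h | h
      · rw [hFl x h]
        intro q hq
        obtain ⟨p, hp, rfl⟩ := exists_of_mem_support_map hq
        exact hS (hrx hp).1 (hf p.1)
      · rw [hFr x h]
        intro q hq
        obtain ⟨p, hp, rfl⟩ := exists_of_mem_support_map hq
        exact hS (hrx hp).1 (hg p.1))
  have hincl : ∀ (z : Cospan) (x : ClassifyingSpace P),
      ((map (Cospan.incl P z) x).weight.support : Set (P × Cospan)) ⊆ {r | r.2 = z} :=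
    fun z x q hq => by
      obtain ⟨p, -, rfl⟩ := exists_of_mem_support_map hq
      rfl
  have hGl : G.comp (map (Cospan.incl P .left)) = map f := by
    ext x : 1
    have h := hincl .left x
    rw [ContinuousMap.comp_apply, hG _ fun r hr => ?_, hFl _ h, ← ContinuousMap.comp_apply,
      ← map_comp]
    · rfl
    · have : r.2 = .left := h hr
      simp [L, this]
  have hGr : G.comp (map (Cospan.incl P .right)) = map g := by
    ext x : 1
    have h := hincl .right x
    rw [ContinuousMap.comp_apply, hG _ fun r hr => ?_, hFr _ h, ← ContinuousMap.comp_apply,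
      ← map_comp]
    · rfl
    · have : r.2 = .right := h hr
      simp [L, this]
  -- Both end inclusions are homotopic to the inclusion at the top; composing with `G` yields the
  -- homotopy from `f` to `g`.
  have h1 := map_homotopic_of_le (Cospan.incl_le_incl_top P .left)
  have h2 := map_homotopic_of_le (Cospan.incl_le_incl_top P .right)
  rw [← hGl, ← hGr]
  exact (ContinuousMap.Homotopic.refl G).comp (h1.trans h2.symm)

end ClassifyingSpace

/-! ### Short paths and distances in graphs of large girth -/

namespace SimpleGraph

variable {W : Type u} {G : SimpleGraph W}

/-- Two paths with the same endpoints are equal if they are too short to contain a cycle. -/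
theorem Walk.IsPath.eq_of_length_add_lt_egirth {a b : W} {p q : G.Walk a b} (hp : p.IsPath)
    (hq : q.IsPath) (h : ((p.length + q.length : ℕ) : ℕ∞) < G.egirth) : p = q := by
  classical
  -- A cycle in the union of the two paths has distinct edges, hence length at most `p.length +
  -- q.length`, below the girth. So the union is acyclic, and paths in it are unique.
  let H : SimpleGraph W := fromEdgeSet {e | e ∈ p.edges ++ q.edges}
  have hG : ∀ e ∈ p.edges ++ q.edges, e ∈ G.edgeSet := fun e he =>
    (List.mem_append.1 he).elim (p.edges_subset_edgeSet ·) (q.edges_subset_edgeSet ·)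
  have hmem : ∀ e ∈ p.edges ++ q.edges, e ∈ H.edgeSet := fun e he => by
    rw [edgeSet_fromEdgeSet]
    exact ⟨he, G.not_isDiag_of_mem_edgeSet (hG e he)⟩
  have hedge : ∀ e ∈ H.edgeSet, e ∈ p.edges ++ q.edges := fun e he => by
    rw [edgeSet_fromEdgeSet] at he
    exact he.1
  have hHG : H ≤ G := edgeSet_subset_edgeSet.1 fun e he => hG e (hedge e he)
  have hacyc : H.IsAcyclic := fun x w hw => by
    have h1 : G.egirth ≤ w.length := (egirth_anti hHG).trans (egirth_le_length hw)
    have h2 : w.length ≤ p.length + q.length := by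
      rw [← w.length_edges, ← List.toFinset_card_of_nodup hw.edges_nodup, ← p.length_edges,
        ← q.length_edges, ← List.length_append]
      refine (Finset.card_le_card fun e he => ?_).trans (List.toFinset_card_le _)
      exact List.mem_toFinset.2 (hedge e (w.edges_subset_edgeSet (List.mem_toFinset.1 he)))
    exact h.not_ge (h1.trans (by exact_mod_cast h2))
  have hpH : ∀ e ∈ p.edges, e ∈ H.edgeSet := fun e he => hmem e (List.mem_append_left _ he)
  have hqH : ∀ e ∈ q.edges, e ∈ H.edgeSet := fun e he => hmem e (List.mem_append_right _ he)
  have heq := congrArg Subtype.val ((hacyc.subsingleton_path a b).elim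
    ⟨p.transfer H hpH, hp.transfer hpH⟩ ⟨q.transfer H hqH, hq.transfer hqH⟩)
  refine Walk.ext_support ?_
  rw [← Walk.support_transfer p hpH, ← Walk.support_transfer q hqH]
  exact congrArg Walk.support heq

/-- Adjacent vertices near `r` have different distances to `r`, if the girth is large. -/
theorem Adj.dist_ne_of_lt_egirth {r x y : W} (hxy : G.Adj x y) (hr : G.Reachable r x)
    (h : ((2 * G.dist r x + 1 : ℕ) : ℕ∞) < G.egirth) : G.dist r x ≠ G.dist r y := by
  classical
  intro he
  obtain ⟨p, hp, hpl⟩ := hr.exists_path_of_dist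
  obtain ⟨q, hq, hql⟩ := (hr.trans hxy.reachable).exists_path_of_dist
  have hy : y ∉ p.support := fun hy => by
    have h1 := p.length_takeUntil_lt_length hy hxy.ne'
    have h2 := dist_le (p.takeUntil y hy)
    omega
  -- Prolonging `p` by the edge to `y` gives a path one longer than `q` with the same ends;
  -- uniqueness contradicts the lengths.
  have heq := (hp.concat hy hxy).eq_of_length_add_lt_egirth hq (by
    rw [Walk.length_concat, hpl, hql, ← he]
    convert h using 2
    omega)
  have := congrArg Walk.length heq
  rw [Walk.length_concat] at this
  omega

/-- A vertex near `r` has at most one neighbour that is closer to `r`, if the girth is large. -/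
theorem Adj.eq_of_dist_succ_of_lt_egirth {r x y z : W} (hy : G.Adj y x) (hz : G.Adj z x)
    (hr : G.Reachable r x) (hdy : G.dist r y + 1 = G.dist r x) (hdz : G.dist r z + 1 = G.dist r x)
    (h : ((2 * G.dist r x : ℕ) : ℕ∞) < G.egirth) : y = z := by
  obtain ⟨p, hp⟩ := (hr.trans hy.symm.reachable).exists_walk_length_eq_dist
  obtain ⟨q, hq⟩ := (hr.trans hz.symm.reachable).exists_walk_length_eq_dist
  have hpl : (p.concat hy).length = G.dist r x := by rw [Walk.length_concat, hp, hdy]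
  have hql : (q.concat hz).length = G.dist r x := by rw [Walk.length_concat, hq, hdz]
  have heq := ((p.concat hy).isPath_of_length_eq_dist hpl).eq_of_length_add_lt_egirth
    ((q.concat hz).isPath_of_length_eq_dist hql) (by rwa [hpl, hql, ← two_mul])
  have := congrArg Walk.penultimate heq
  rwa [Walk.penultimate_concat, Walk.penultimate_concat] at this

theorem Reachable.exists_adj_dist_succ {r x : W} (hr : G.Reachable r x) (hd : G.dist r x ≠ 0) :
    ∃ y, G.Adj x y ∧ G.dist r y + 1 = G.dist r x := by
  obtain ⟨p, hp⟩ := hr.symm.exists_walk_length_eq_dist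
  rw [dist_comm] at hp
  cases p with
  | nil => exact (hd (by simp)).elim
  | cons hadj p =>
    rename_i y
    refine ⟨y, hadj, ?_⟩
    rw [Walk.length_cons] at hp
    have h1 : G.dist r y ≤ p.length := by
      rw [dist_comm]
      exact dist_le p
    obtain ⟨s, hs⟩ := (hr.trans hadj.reachable).exists_walk_length_eq_dist
    have h2 := dist_le (s.concat hadj.symm)
    rw [Walk.length_concat] at h2
    omega

end SimpleGraph

/-! ### Folding a rooted tree level by level -/

namespace MultiHom

variable {V : Type u} {W : Type v} {T : LoopGraph V} {X : LoopGraph W}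

instance [Finite V] [Finite W] : Finite (MultiHom T X) :=
  Finite.of_injective MultiHom.toFun fun _ _ h => MultiHom.ext h

/-- The set `M` of vertices of `X` spans a tree whose vertices of positive level `d` have the
parent `par`. -/
structure IsLevelTree (X : LoopGraph W) (M : Set W) (d : W → ℕ) (par : W → W) : Prop where
  par_mem : ∀ x ∈ M, d x ≠ 0 → par x ∈ M
  adj_par : ∀ x ∈ M, d x ≠ 0 → X.Adj x (par x)
  level_par : ∀ x ∈ M, d x ≠ 0 → d (par x) + 1 = d x
  level_eq : ∀ x ∈ M, ∀ y ∈ M, X.Adj x y → d x ≤ d y → d x + 1 = d y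
  eq_par : ∀ x ∈ M, ∀ y ∈ M, X.Adj x y → d x ≤ d y → x = par y

/-- The multi-homomorphisms with values in `M`, compatible with the colouring `c` and the parity
of the level `d`, and of level at most `k`. -/
def levelSet (c : LoopGraph.Hom T (LoopGraph.K 2)) (X : LoopGraph W) (M : Set W) (d : W → ℕ)
    (k : ℕ) : Set (MultiHom T X) :=
  {ζ | ∀ v, ∀ x ∈ ζ.toFun v, x ∈ M ∧ (Even (d x) ↔ c v = 0) ∧ d x ≤ k}

variable {c : LoopGraph.Hom T (LoopGraph.K 2)} {M : Set W} {d : W → ℕ} {par : W → W}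

theorem levelSet_mono {k l : ℕ} (h : k ≤ l) : levelSet c X M d k ⊆ levelSet c X M d l :=
  fun _ hζ v x hx => ⟨(hζ v x hx).1, (hζ v x hx).2.1, (hζ v x hx).2.2.trans h⟩

namespace IsLevelTree

/-- Grandparents rather than parents are used because they preserve the parity of the level, hence
the colour. -/
theorem grandparent (h : IsLevelTree X M d par) {x : W} (hx : x ∈ M) (hd : 2 ≤ d x) :
    par (par x) ∈ M ∧ X.Adj (par x) (par (par x)) ∧ d (par (par x)) + 2 = d x := by
  have h1 := h.level_par x hx (by omega)
  have hm := h.par_mem x hx (by omega)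
  have h2 := h.level_par _ hm (by omega)
  exact ⟨h.par_mem _ hm (by omega), h.adj_par _ hm (by omega), by omega⟩

/-- Adding their grandparents to the values of top level. -/
def grow (h : IsLevelTree X M d par) {k : ℕ} (hk : 1 ≤ k) :
    levelSet c X M d (k + 1) →o levelSet c X M d (k + 1) where
  toFun ζ :=
    ⟨{  toFun := fun v => ζ.1.toFun v ∪ (par ∘ par) '' {x ∈ ζ.1.toFun v | d x = k + 1}
        nonempty := fun v => (ζ.1.nonempty v).mono Set.subset_union_left
        adj := by
          -- A neighbour `y` of a top-level `x` can only be its parent, which is also adjacent to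
          -- the grandparent.
          have key : ∀ {a b : V}, T.Adj a b → ∀ x ∈ ζ.1.toFun a, ∀ y ∈ ζ.1.toFun b,
              d x = k + 1 → d y ≠ k + 1 ∧ X.Adj (par (par x)) y := by
            intro a b hab x hx y hy hdx
            have hxM := (ζ.2 a x hx).1
            obtain ⟨hyM, -, hdy⟩ := ζ.2 b y hy
            have hadj := ζ.1.adj hab x hx y hy
            have h1 := h.level_eq y hyM x hxM (X.symm hadj) (by omega)
            refine ⟨by omega, ?_⟩
            rw [h.eq_par y hyM x hxM (X.symm hadj) (by omega)]
            exact X.symm (h.grandparent hxM (by omega)).2.1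
          rintro a b hab x (hx | ⟨x, ⟨hx, hdx⟩, rfl⟩) y (hy | ⟨y, ⟨hy, hdy⟩, rfl⟩)
          · exact ζ.1.adj hab x hx y hy
          · exact X.symm (key (T.symm hab) y hy x hx hdy).2
          · exact (key hab x hx y hy hdx).2
          · exact ((key hab x hx y hy hdx).1 hdy).elim },
      by
        rintro v x (hx | ⟨x, ⟨hx, hdx⟩, rfl⟩)
        · exact ζ.2 v x hx
        · obtain ⟨hxM, hpar, -⟩ := ζ.2 v x hx
          obtain ⟨h1, -, h2⟩ := h.grandparent hxM (by omega)
          refine ⟨h1, ?_, ?_⟩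
          · rw [← hpar, ← h2, Nat.even_add]
            simp
          · simp only [Function.comp_apply]
            omega⟩
  monotone' ζ ζ' hζ v := Set.union_subset_union (hζ v)
    (Set.image_mono fun _ hx => ⟨hζ v hx.1, hx.2⟩)

/-- Replacing the values of top level by their grandparents. -/
def fold (h : IsLevelTree X M d par) {k : ℕ} (hk : 1 ≤ k) :
    levelSet c X M d (k + 1) →o levelSet c X M d k where
  toFun ζ :=
    ⟨{  toFun := fun v => {x ∈ (h.grow hk ζ).1.toFun v | d x ≤ k}
        nonempty := fun v => by
          obtain ⟨x, hx⟩ := ζ.1.nonempty v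
          obtain ⟨hxM, -, hdx⟩ := ζ.2 v x hx
          rcases hdx.lt_or_eq with hlt | heq
          · exact ⟨x, Or.inl hx, by omega⟩
          · refine ⟨par (par x), Or.inr ⟨x, ⟨hx, heq⟩, rfl⟩, ?_⟩
            have := (h.grandparent hxM (by omega)).2.2
            omega
        adj := fun hab x hx y hy => (h.grow hk ζ).1.adj hab x hx.1 y hy.1 },
      fun v x hx => ⟨((h.grow hk ζ).2 v x hx.1).1, ((h.grow hk ζ).2 v x hx.1).2.1, hx.2⟩⟩
  monotone' _ _ hζ v _ hx := ⟨(h.grow hk).monotone hζ v hx.1, hx.2⟩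

/-- Levels 0 and 1 form a star with centre `r`. The largest element takes the value `{r}` on colour
0 and all leaves on colour 1; `s` ensures that there is a leaf. -/
theorem contractibleSpace_levelSet_one [Finite V] [Finite W] (h : IsLevelTree X M d par) {r s : W}
    (hr : ∀ x, x ∈ M ∧ d x = 0 ↔ x = r) (hs : s ∈ M ∧ d s = 1) :
    ContractibleSpace (ClassifyingSpace (levelSet c X M d 1)) := by
  classical
  have hrx : ∀ x ∈ M, d x = 1 → X.Adj x r := fun x hx hdx => by
    have h1 := h.level_par x hx (by omega)
    rw [← (hr (par x)).1 ⟨h.par_mem x hx (by omega), by omega⟩]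
    exact h.adj_par x hx (by omega)
  have hr' := (hr r).2 rfl
  let ζ : levelSet c X M d 1 :=
    ⟨{  toFun := fun v => if c v = 0 then {r} else {x | x ∈ M ∧ d x = 1}
        nonempty := fun v => by
          split_ifs
          · exact ⟨r, rfl⟩
          · exact ⟨s, hs⟩
        adj := by
          intro a b hab x hx y hy
          have hc : c a ≠ c b := c.map_rel hab
          split_ifs at hx hy with h1 h2 h2
          · exact (hc (h1.trans h2.symm)).elim
          · rw [Set.mem_singleton_iff.1 hx]
            exact X.symm (hrx y hy.1 hy.2)
          · rw [Set.mem_singleton_iff.1 hy]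
            exact hrx x hx.1 hx.2
          · exact (hc (by omega)).elim },
      by
        intro v x hx
        simp only at hx
        split_ifs at hx with hv
        · rw [Set.mem_singleton_iff.1 hx]
          simp [hr', hv]
        · simp [hx.1, hx.2, hv]⟩
  refine ClassifyingSpace.contractibleSpace_of_isTop (p := ζ) fun ξ v x hx => ?_
  obtain ⟨hxM, hpar, hd⟩ := ξ.2 v x hx
  change x ∈ if c v = 0 then {r} else {x | x ∈ M ∧ d x = 1}
  split_ifs with hv
  · refine (hr x).1 ⟨hxM, ?_⟩
    have := hpar.2 hv
    interval_cases hdx : d x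
    · rfl
    · exact absurd this (by decide)
  · refine ⟨hxM, ?_⟩
    have := mt hpar.1 hv
    interval_cases hdx : d x
    · exact absurd (by decide) this
    · rfl

/-- Induction on the height: `ζ ≤ grow ζ ≥ fold ζ` deforms the poset into the one of smaller height.
-/
theorem contractibleSpace_levelSet [Finite V] [Finite W] (h : IsLevelTree X M d par) {r s : W}
    (hr : ∀ x, x ∈ M ∧ d x = 0 ↔ x = r) (hs : s ∈ M ∧ d s = 1) {k : ℕ} (hk : 1 ≤ k) :
    ContractibleSpace (ClassifyingSpace (levelSet c X M d k)) := by
  induction k, hk using Nat.le_induction with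
  | base => exact h.contractibleSpace_levelSet_one hr hs
  | succ k hk ih =>
    let i : levelSet c X M d k →o levelSet c X M d (k + 1) :=
      { toFun := fun ζ => ⟨ζ.1, levelSet_mono k.le_succ ζ.2⟩
        monotone' := fun _ _ hζ => hζ }
    refine ClassifyingSpace.contractibleSpace_of_homotopic_id i (h.fold hk) ?_ ih
    have h1 : i.comp (h.fold hk) ≤ h.grow (c := c) hk := fun ζ v x hx => hx.1
    have h2 : OrderHom.id ≤ h.grow (c := c) hk := fun ζ v x hx => Or.inl hx
    rw [← ClassifyingSpace.map_id]
    exact (ClassifyingSpace.map_homotopic_of_le h1).trans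
      (ClassifyingSpace.map_homotopic_of_le h2).symm

end IsLevelTree

end MultiHom

/-! ### The tree spanned by the values of a multi-homomorphism -/

namespace LoopGraph

variable {W : Type v}

theorem not_adj_self_of_one_lt_egirth {X : LoopGraph W} (h : 1 < X.egirth) (x : W) :
    ¬X.Adj x x := fun hx => by
  rw [egirth, if_pos ⟨x, hx⟩] at h
  exact h.ne rfl

theorem egirth_le_egirth_toSimpleGraph (X : LoopGraph W) : X.egirth ≤ X.toSimpleGraph.egirth := by
  rw [egirth]
  split_ifs
  · exact le_trans (by norm_num) SimpleGraph.three_le_egirth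
  · exact le_rfl

/-- The simple graph of edges of `X` inside of `M`. -/
def simpleGraphOn (X : LoopGraph W) (M : Set W) : SimpleGraph W where
  Adj x y := x ∈ M ∧ y ∈ M ∧ X.toSimpleGraph.Adj x y
  symm := ⟨fun _ _ h => ⟨h.2.1, h.1, h.2.2.symm⟩⟩
  loopless := ⟨fun _ h => h.2.2.ne rfl⟩

end LoopGraph

namespace MultiHom

variable {V : Type u} {W : Type v} {T : LoopGraph V} {X : LoopGraph W}

/-- The vertices of the target that occur in a multi-homomorphism. -/
def support (η : MultiHom T X) : Set W := {x | ∃ v, x ∈ η.toFun v}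

/-- The multi-homomorphisms whose value at each vertex consists of values of `η` at vertices of
the same colour. -/
def colourHull (c : LoopGraph.Hom T (LoopGraph.K 2)) (η : MultiHom T X) : Set (MultiHom T X) :=
  {ζ | ∀ v, ∀ x ∈ ζ.toFun v, ∃ w, c w = c v ∧ x ∈ η.toFun w}

variable {c : LoopGraph.Hom T (LoopGraph.K 2)}

theorem colourHull_mono : Monotone (colourHull (X := X) c) := fun _ _ h _ hζ v x hx =>
  (hζ v x hx).imp fun w hw => ⟨hw.1, h w hw.2⟩

/-- Values are chosen freely at the inner vertices of the walk. Length zero is excluded because `x`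
and `z` could be different values at one vertex. -/
theorem exists_walk_of_walk (hX : ∀ x, ¬X.Adj x x) (η : MultiHom T X) {a b : V}
    (p : T.toSimpleGraph.Walk a b) (hp : p.length ≠ 0) {x z : W} (hx : x ∈ η.toFun a)
    (hz : z ∈ η.toFun b) :
    ∃ q : (X.simpleGraphOn η.support).Walk x z, q.length = p.length := by
  have hadj : ∀ {a b : V}, T.Adj a b → ∀ {x y : W}, x ∈ η.toFun a → y ∈ η.toFun b →
      (X.simpleGraphOn η.support).Adj x y := fun {a b} hab {x y} hx hy =>
    have h := η.adj hab x hx y hy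
    ⟨⟨a, hx⟩, ⟨b, hy⟩, fun he => hX x (by rwa [← he] at h), h⟩
  induction p generalizing x with
  | nil => exact (hp rfl).elim
  | @cons a m b h p ih =>
    by_cases h0 : p.length = 0
    · obtain rfl := SimpleGraph.Walk.eq_of_length_eq_zero h0
      exact ⟨(hadj h.2 hx hz).toWalk, by simp [h0]⟩
    · obtain ⟨y, hy⟩ := η.nonempty m
      obtain ⟨q, hq⟩ := ih h0 hy hz
      exact ⟨.cons (hadj h.2 hx hy) q, by simp [hq]⟩

/-- If the girth of `X` is large, then the values of a multi-homomorphism span a tree. -/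
theorem contractibleSpace_colourHull [Finite V] [Finite W] (hconn : T.Connected)
    (hdiam : 0 < T.diam) (hgirth : ((2 * T.diam + 4 : ℕ) : ℕ∞) < X.egirth) {a b : V}
    (hab : T.Adj a b) (hca : c a = 0) (η : MultiHom T X) :
    ContractibleSpace (ClassifyingSpace (colourHull c η)) := by
  classical
  have hX := X.not_adj_self_of_one_lt_egirth (lt_of_le_of_lt (by norm_cast; omega) hgirth)
  have hc : ∀ {v w : V}, T.Adj v w → c v ≠ c w := fun h => c.map_rel h
  let G := X.simpleGraphOn η.support
  have hG : X.egirth ≤ G.egirth := X.egirth_le_egirth_toSimpleGraph.trans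
    (SimpleGraph.egirth_anti fun _ _ h => h.2.2)
  obtain ⟨r, hr⟩ := η.nonempty a
  obtain ⟨s, hs⟩ := η.nonempty b
  have habT : T.toSimpleGraph.Adj a b := ⟨fun h => hc hab (h ▸ rfl), hab⟩
  -- The values at `a` itself are reached by the walk `a, b, a`, whose length 2 is at most `Δ + 1`
  -- since `Δ > 0`; all others are within `Δ`.
  have hdist : ∀ x ∈ η.support, G.Reachable r x ∧ G.dist r x ≤ T.diam + 1 := by
    rintro x ⟨v, hx⟩
    obtain ⟨p, hp0, hp⟩ : ∃ p : T.toSimpleGraph.Walk a v, p.length ≠ 0 ∧ p.length ≤ T.diam + 1 := by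
      rcases eq_or_ne a v with rfl | hne
      · exact ⟨.cons habT (.cons habT.symm .nil), by simp, by simp; omega⟩
      · obtain ⟨p, hp⟩ := hconn.exists_walk_length_eq_dist a v
        have := hconn.nonempty
        have h1 : T.toSimpleGraph.dist a v ≤ T.diam :=
          SimpleGraph.dist_le_diam (SimpleGraph.connected_iff_ediam_ne_top.1 hconn)
        have h2 := hconn.pos_dist_of_ne hne
        exact ⟨p, by omega, by omega⟩
    obtain ⟨q, hq⟩ := exists_walk_of_walk hX η p hp0 hr hx
    exact ⟨q.reachable, (SimpleGraph.dist_le q).trans (hq.trans_le hp)⟩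
  -- With levels at most `Δ + 1`, excluding edges within a level needs `2Δ + 3` below the girth, and
  -- uniqueness of parents needs `2Δ + 2`.
  have hlt : ∀ n : ℕ, n ≤ 2 * T.diam + 4 → (n : ℕ∞) < G.egirth := fun n hn =>
    lt_of_le_of_lt (by exact_mod_cast hn) (hgirth.trans_le hG)
  have hpar : ∀ x, ∃ y, x ∈ η.support → G.dist r x ≠ 0 →
      G.Adj x y ∧ G.dist r y + 1 = G.dist r x := fun x => by
    by_cases h : x ∈ η.support ∧ G.dist r x ≠ 0
    · obtain ⟨y, hy⟩ := (hdist x h.1).1.exists_adj_dist_succ h.2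
      exact ⟨y, fun _ _ => hy⟩
    · exact ⟨x, fun h1 h2 => (h ⟨h1, h2⟩).elim⟩
  choose par hpar using hpar
  have hGadj : ∀ x ∈ η.support, ∀ y ∈ η.support, X.Adj x y → G.Adj x y := fun x hx y hy h =>
    ⟨hx, hy, fun he => hX x (by rwa [← he] at h), h⟩
  have hlevel : ∀ x ∈ η.support, ∀ y ∈ η.support, X.Adj x y → G.dist r x ≤ G.dist r y →
      G.dist r x + 1 = G.dist r y := by
    intro x hx y hy hxy hle
    have hGxy := hGadj x hx y hy hxy
    have hne := hGxy.dist_ne_of_lt_egirth (hdist x hx).1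
      (hlt _ (by have := (hdist x hx).2; omega))
    obtain ⟨p, hp⟩ := (hdist x hx).1.exists_walk_length_eq_dist
    have h1 := SimpleGraph.dist_le (p.concat hGxy)
    rw [SimpleGraph.Walk.length_concat] at h1
    omega
  have htree : IsLevelTree X η.support (G.dist r) par :=
    { par_mem := fun x hx hd => (hpar x hx hd).1.2.1
      adj_par := fun x hx hd => (hpar x hx hd).1.2.2.2
      level_par := fun x hx hd => (hpar x hx hd).2
      level_eq := hlevel
      eq_par := fun x hx y hy hxy hle => by
        have h1 := hlevel x hx y hy hxy hle
        have h2 := hpar y hy (by omega)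
        exact (hGadj x hx y hy hxy).eq_of_dist_succ_of_lt_egirth h2.1.symm (hdist y hy).1 h1 h2.2
          (hlt _ (by have := (hdist y hy).2; omega)) }
  have hflip : ∀ {x y : W}, x ∈ η.support → y ∈ η.support → X.Adj x y →
      (Even (G.dist r y) ↔ ¬Even (G.dist r x)) := by
    intro x y hx hy hxy
    rcases le_total (G.dist r x) (G.dist r y) with h | h
    · rw [← hlevel x hx y hy hxy h, Nat.even_add_one]
    · rw [← hlevel y hy x hx (X.symm hxy) h, Nat.even_add_one, not_not]
  -- The propagation starts at `b`, all of whose values are adjacent to `r`; along an edge of `T`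
  -- both colour and parity flip.
  have hparity : ∀ v, ∀ x ∈ η.toFun v, Even (G.dist r x) ↔ c v = 0 := by
    have hb : ∀ x ∈ η.toFun b, Even (G.dist r x) ↔ c b = 0 := fun x hx => by
      have := hc hab
      rw [hflip ⟨a, hr⟩ ⟨b, hx⟩ (η.adj hab r hr x hx), SimpleGraph.dist_self]
      simp [← hca, this.symm]
    have hwalk : ∀ {w v : V}, T.toSimpleGraph.Walk w v →
        (∀ x ∈ η.toFun w, Even (G.dist r x) ↔ c w = 0) →
        ∀ x ∈ η.toFun v, Even (G.dist r x) ↔ c v = 0 := by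
      intro w v p
      induction p with
      | nil => exact id
      | @cons w m v h p ih =>
        refine fun hw => ih fun y hy => ?_
        obtain ⟨x, hx⟩ := η.nonempty w
        have := hc h.2
        rw [hflip ⟨w, hx⟩ ⟨m, hy⟩ (η.adj h.2 x hx y hy), hw x hx]
        omega
    intro v
    obtain ⟨p⟩ := hconn.preconnected b v
    exact hwalk p hb
  have hroot : ∀ x, x ∈ η.support ∧ G.dist r x = 0 ↔ x = r := fun x => by
    constructor
    · rintro ⟨hx, h0⟩
      exact ((hdist x hx).1.dist_eq_zero_iff.1 h0).symm
    · rintro rfl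
      exact ⟨⟨a, hr⟩, SimpleGraph.dist_self⟩
  have hs1 : s ∈ η.support ∧ G.dist r s = 1 :=
    ⟨⟨b, hs⟩, SimpleGraph.dist_eq_one_iff_adj.2
      (hGadj r ⟨a, hr⟩ s ⟨b, hs⟩ (η.adj hab r hr s hs))⟩
  -- Parity determines the colour of every vertex at which `x` is a value, and the height bound
  -- holds on the whole support.
  have heq : colourHull c η = levelSet c X η.support (G.dist r) (T.diam + 1) := by
    ext ζ
    refine forall_congr' fun v => forall_congr' fun x => forall_congr' fun _ => ?_
    constructor
    · rintro ⟨w, hw, hx⟩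
      exact ⟨⟨w, hx⟩, hw ▸ hparity w x hx, (hdist x ⟨w, hx⟩).2⟩
    · rintro ⟨⟨w, hx⟩, hp, -⟩
      have := (hparity w x hx).symm.trans hp
      exact ⟨w, by omega, hx⟩
  rw [heq]
  exact htree.contractibleSpace_levelSet hroot hs1 (by omega)

/-! ### Retracting `T` onto an edge, and the homotopy equivalence -/

theorem pullback_comp_pullback_of_leftInverse {V' : Type w} {T' : LoopGraph V'}
    (f : LoopGraph.Hom T' T) (g : LoopGraph.Hom T T') (h : ∀ v, g (f v) = v) :
    (pullback f X).comp (pullback g X) = OrderHom.id := by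
  ext η : 2
  refine MultiHom.ext (funext fun v => ?_)
  exact congrArg η.toFun (h v)

end MultiHom

/-- Any 2-colouring separates the ends of the edge `f`; exchange the colours if they come in the
wrong order. -/
theorem LoopGraph.IsBipartite.exists_colouring {V : Type u} {T : LoopGraph V} (h : T.IsBipartite)
    (f : LoopGraph.Hom (LoopGraph.K 2) T) :
    ∃ c : LoopGraph.Hom T (LoopGraph.K 2), ∀ i, c (f i) = i := by
  obtain ⟨b⟩ := h
  have hb : b (f 0) ≠ b (f 1) := b.map_rel (f.map_rel (show (0 : Fin 2) ≠ 1 by decide))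
  by_cases h0 : b (f 0) = 0
  · refine ⟨b, fun i => ?_⟩
    fin_cases i
    · exact h0
    · change b (f 1) = 1
      omega
  · refine ⟨⟨fun v => Equiv.swap 0 1 (b v), fun hvw => ?_⟩, fun i => ?_⟩
    · exact (Equiv.swap (0 : Fin 2) 1).injective.ne (b.map_rel hvw)
    · have h0' : b (f 0) = 1 := by omega
      have h1' : b (f 1) = 0 := by omega
      fin_cases i
      · change Equiv.swap 0 1 (b (f 0)) = 0
        rw [h0', Equiv.swap_apply_right]
      · change Equiv.swap 0 1 (b (f 1)) = 1
        rw [h1', Equiv.swap_apply_left]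

end

theorem lemma4p4 {V : Type*} {W : Type*} [Finite V] [Finite W]
    (T : LoopGraph V) (X : LoopGraph W)
    (hconn : T.Connected) (hbip : T.IsBipartite) (hdiam : 0 < T.diam)
    (hgirth : ((2 * T.diam + 4 : ℕ) : ℕ∞) < X.egirth)
    (u : LoopGraph.Hom (LoopGraph.K 2) T) :
    IsHomotopyEquiv (ClassifyingSpace.map (MultiHom.pullback u X)) := by
  obtain ⟨c, hc⟩ := hbip.exists_colouring u
  refine ⟨ClassifyingSpace.map (MultiHom.pullback c X), ?_, ?_⟩
  · rw [← ClassifyingSpace.map_comp, ← ClassifyingSpace.map_id]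
    -- The composite sends `η` to `v ↦ η (u (c v))`, and `u (c v)` has the colour of `v`, so the
    -- hull carries it as well as the identity.
    refine ClassifyingSpace.map_homotopic_of_carrier _ _ (MultiHom.colourHull c)
      MultiHom.colourHull_mono (fun η v x hx => ⟨u (c v), hc _, hx⟩)
      (fun η v x hx => ⟨v, rfl, hx⟩) fun η => ?_
    exact MultiHom.contractibleSpace_colourHull hconn hdiam hgirth
      (u.map_rel (show (0 : Fin 2) ≠ 1 by decide)) (hc 0) η
  · rw [← ClassifyingSpace.map_comp, MultiHom.pullback_comp_pullback_of_leftInverse u c hc,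
      ClassifyingSpace.map_id]
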